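/- \textbf{Setting.} Let $V$ be a finite set of users, $\mathcal B\subseteq V$ a set of broadcasters, $\mathcal E'\subseteq \mathcal B\times V$ a set of candidate links (the link $(i,j)$ makes $j$ a follower of $i$), $\mathcal W_{i,:}=\{j:(i,j)\in\mathcal E'\}$, $c_i\in\mathbb N$ budgets, $K\in\mathbb N$ and $0\le t_0\le t_f$. On a probability space, broadcaster $i\in\mathcal B$ posts according to a Poisson process on $[0,t_f]$ with a nonnegative integrable intensity $\mu_i(t)$, and user $j$ receives the posts of the accounts she already follows according to a Poisson process on $[0,t_f]$ with a nonnegative integrable intensity $\gamma_j(t)$; for every $j$, the latter process and the processes of the broadcasters $i$ with $(i,j)\in\mathcal E'$ are independent. For $S\subseteq\mathcal E'$, the feed of $j$ at time $t$ lists, in inverse chronological order, the posts up to time $t$ of the accounts she already follows and of all $i$ with $(i,j)\in S$. Let $r(t,S,j)$ be the number of positions among the top $K$ of this feed that are held by posts of broadcasters $i$ with $(i,j)\in S$, and put $$\mathcal U(S,j)=\mathbb E\Big[\int_{t_0}^{t_f} r(t,S,j)\,dt\Big],\qquad F(S)=\sum_{j\in V}\mathcal U(S,j).$$ From $n$ independent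 realizations of all the posts, form the empirical estimates $$\hat{\mathcal U}(S,j)=\frac1n\sum_{k=1}^K\sum_{\ell=1}^n\Delta^{(\ell)}_{k,j}(S),\qquad \hat F(S)=\sum_{j\in V}\hat{\mathcal U}(S,j),$$ where $\Delta^{(\ell)}_{k,j}(S)$ is the amount of time in $[t_0,t_f]$ during which, in realization $\ell$, position $k$ of the feed of $j$ is held by a post of a broadcaster $i$ with $(i,j)\in S$. Call $S\subseteq\mathcal E'$ feasible if $|\{j:(i,j)\in S\}|\le c_i$ for all $i\in\mathcal B$, and let $OPT$ be the maximum of $F$ over the feasible sets. Let $\alpha\in[0,1]$ be the generalized curvature of $F$, i.e. the smallest $\alpha\in[0,1]$ such that $F(A\cup\{v\})-F(A)\ge(1-\alpha)\,(F(B\cup\{v\})-F(B))$ for all $v\in\mathcal E'$ and $A\subseteq B\subseteq\mathcal E'$, and let $\xi=1-\alpha$. The greedy algorithm with objective $\hat F$ starts from $S=\emptyset$ and repeatedly considers a link $v\in\mathcal E'$, among those not considered so far, that maximizes $\hat F(S\cup\{v\})-\hat F(S)$ (ties are broken arbitrarily); it adds $v$ to $S$ if $S\cup\{v\}$ is feasible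 and discards $v$ otherwise. It returns $S$ when all links have been considered. \textbf{Theorem.} There are real numbers $Z_y$ and $Q_y>0$ for $y\in(0,1]$, depending only on $y$, such that for every instance as above and every $y\in(0,1]$ the following two statements hold. (i) For all $n$, all $S\subseteq\mathcal E'$ and all $j\in V$, $$\mathbb P\{\mathcal U(S,j)-yK(t_f-t_0)\le\hat{\mathcal U}(S,j)\le\mathcal U(S,j)+yK(t_f-t_0)\}\ge 1-e^{Z_y-Q_yn}.$$ (ii) Let $\delta>0$ and let $n\ge\dfrac{Z_y+\log\frac{\sum_{i\in\mathcal B}|\mathcal W_{i,:}|}{\delta}}{Q_y}$ (with $\log 0$ read as $0$ if $\mathcal E'=\emptyset$). Then, with probability at least $1-\delta$, every set $\mathcal E_{\mathcal B}$ that the greedy algorithm with objective $\hat F$ can return satisfies $$F(\mathcal E_{\mathcal B})\ \ge\ \frac{1}{\frac1\xi+1}\,OPT\;-\;4yK(t_f-t_0)\sum_{i\in\mathcal B}c_i,$$ where $\frac{1}{1/\xi+1}=\frac{\xi}{1+\xi}$ is read as $0$ if $\xi=0$. (For $n=0$ the empirical estimates are understood to be $0$.) -/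

import Mathlib

open MeasureTheory ProbabilityTheory

noncomputable section

namespace LinkRec

/-! ### Set functions and the greedy algorithm -/

/-- The marginal gain `ρ_v(A) = f (A ∪ {v}) - f A`. -/
def marginal {E : Type*} [DecidableEq E] (f : Finset E → ℝ) (v : E) (A : Finset E) : ℝ :=
  f (insert v A) - f A

/-- `f` is `α`-submodular on the ground set `G`: `ρ_v(A) ≥ (1 - α) ρ_v(B)` for all `v` and all
`A ⊆ B`. -/
def IsAlphaSubmodular {E : Type*} [DecidableEq E] (G : Finset E) (f : Finset E → ℝ) (α : ℝ) :
    Prop :=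
  ∀ v ∈ G, ∀ A B : Finset E, A ⊆ B → B ⊆ G → (1 - α) * marginal f v B ≤ marginal f v A

/-- The generalized curvature of a nondecreasing set function `f` on the ground set `G`: the
smallest `α` for which `f` is `α`-submodular. It always lies in `[0, 1]` unless all marginal gains
vanish, and in that degenerate case this definition gives `0`. -/
def generalizedCurvature {E : Type*} [DecidableEq E] (G : Finset E) (f : Finset E → ℝ) : ℝ :=
  sInf {α : ℝ | 0 ≤ α ∧ α ≤ 1 ∧ IsAlphaSubmodular G f α}

/-- `GreedyState G I f S U`: on the ground set `G`, with independent sets `I` and objective `f`, some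
run of the greedy algorithm (ties in the argmax are broken arbitrarily) reaches a state in which
`S` is the set of selected items and `U` the set of considered items. In each step an unconsidered
item of maximal marginal gain is considered, and it is selected if that keeps `S` independent. -/
inductive GreedyState {E : Type*} [DecidableEq E] (G : Finset E) (I : Finset E → Prop)
    (f : Finset E → ℝ) : Finset E → Finset E → Prop
  | start : GreedyState G I f ∅ ∅
  | select (S U : Finset E) (v : E) : GreedyState G I f S U → v ∈ G \ U →
      (∀ w ∈ G \ U, marginal f w S ≤ marginal f v S) → I (insert v S) →
      GreedyState G I f (insert v S) (insert v U)
  | discard (S U : Finset E) (v : E) : GreedyState G I f S U → v ∈ G \ U →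
      (∀ w ∈ G \ U, marginal f w S ≤ marginal f v S) → ¬ I (insert v S) →
      GreedyState G I f S (insert v U)

/-- `S` is a set returned by (some run of) the greedy algorithm: every item has been considered. -/
def IsGreedyOutput {E : Type*} [DecidableEq E] (G : Finset E) (I : Finset E → Prop)
    (f : Finset E → ℝ) (S : Finset E) : Prop :=
  GreedyState G I f S G

/-- The optimal value of `f` over the independent subsets of `G`. -/
def optValue {E : Type*} (G : Finset E) (I : Finset E → Prop) (f : Finset E → ℝ) : ℝ :=
  sSup {x : ℝ | ∃ A : Finset E, A ⊆ G ∧ I A ∧ f A = x}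

/-! ### Point processes on a bounded time window

A realization of a point process on `[0, T]` is a finite set of times. -/

/-- The number of points of `s` that lie in `A`. -/
def countIn (s : Finset ℝ) (A : Set ℝ) : ℕ := ((s : Set ℝ) ∩ A).ncard

/-- The σ-algebra generated by a random finite set of times, i.e. by its counts in Borel sets. -/
@[reducible] def pointSigma {Ω : Type*} (N : Ω → Finset ℝ) : MeasurableSpace Ω :=
  ⨆ A : {A : Set ℝ // MeasurableSet A},
    MeasurableSpace.comap (fun ω => countIn (N ω) A.1) (⊤ : MeasurableSpace ℕ)

/-- `N` is a Poisson process on `[0, T]` with the (deterministic) intensity function `lam`. -/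
structure IsPoissonProcess {Ω : Type*} [MeasurableSpace Ω] (P : Measure Ω) (T : ℝ) (lam : ℝ → ℝ)
    (N : Ω → Finset ℝ) : Prop where
  mem_window : ∀ ω, ∀ τ ∈ N ω, τ ∈ Set.Icc 0 T
  measurable_count : ∀ A : Set ℝ, MeasurableSet A → Measurable fun ω => countIn (N ω) A
  count_law : ∀ A : Set ℝ, MeasurableSet A → A ⊆ Set.Icc 0 T →
    P.map (fun ω => countIn (N ω) A) = poissonMeasure (∫ t in A, lam t).toNNReal
  indep_counts : ∀ (m : ℕ) (A : Fin m → Set ℝ), (∀ k, MeasurableSet (A k)) →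
    Pairwise (Function.onFun Disjoint A) → iIndepFun (fun k ω => countIn (N ω) (A k)) P

/-! ### Feeds and visibility -/

/-- The data of the visibility optimization problem on a set `V` of users. -/
structure Problem (V : Type*) where
  /-- number of top positions that count as visible -/
  K : ℕ
  /-- start of the observation window -/
  t₀ : ℝ
  /-- end of the observation window -/
  tf : ℝ
  /-- the broadcasters -/
  broadcasters : Finset V
  /-- the candidate links; `(i, j)` means that `j` would follow the broadcaster `i` -/
  links : Finset (V × V)
  /-- the maximal number `c_i` of links that broadcaster `i` can afford -/
  budget : V → ℕ
  /-- the intensity `μ_i` at which broadcaster `i` posts -/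
  mu : V → ℝ → ℝ
  /-- the intensity `γ_j` at which user `j` receives posts from the accounts already followed -/
  gam : V → ℝ → ℝ
  t₀_nonneg : 0 ≤ t₀
  t₀_le_tf : t₀ ≤ tf
  source_mem : ∀ e ∈ links, e.1 ∈ broadcasters
  mu_nonneg : ∀ i ∈ broadcasters, ∀ t ∈ Set.Icc 0 tf, 0 ≤ mu i t
  mu_integrable : ∀ i ∈ broadcasters, IntegrableOn (mu i) (Set.Icc 0 tf)
  gam_nonneg : ∀ j, ∀ t ∈ Set.Icc 0 tf, 0 ≤ gam j t
  gam_integrable : ∀ j, IntegrableOn (gam j) (Set.Icc 0 tf)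

/-- The feed at time `t` in reverse chronological order, for a user who receives the posts of the
new broadcasters in `R` (post times `post i`) and the other posts `back`: the list of the pairs
(post time, flag) for all posts up to time `t`, most recent first. The flag is `true` for a post of
a broadcaster in `R`. (Simultaneous posts have probability zero; the lexicographic order makes the
list well defined in that case, too.) -/
def feed {V : Type*} (post : V → Finset ℝ) (back : Finset ℝ) (R : Finset V) (t : ℝ) :
    List (ℝ ×ₗ Bool) :=
  (((∑ i ∈ R, (post i).val.map fun τ => toLex (τ, true)) +
      back.val.map fun τ => toLex (τ, false)).filter fun p => (ofLex p).1 ≤ t).sort (· ≥ ·)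

/-- The `k`-th position (`k = 1, 2, …`) of the feed at time `t` is held by a post of a broadcaster
in `R`. -/
def HoldsPosition {V : Type*} (post : V → Finset ℝ) (back : Finset ℝ) (R : Finset V) (t : ℝ)
    (k : ℕ) : Prop :=
  ∃ τ : ℝ, (feed post back R t)[k - 1]? = some (toLex (τ, true))

/-- `r(t)`: the number of posts of broadcasters in `R` among the top `K` positions at time `t`. -/
def topCount {V : Type*} (K : ℕ) (post : V → Finset ℝ) (back : Finset ℝ) (R : Finset V) (t : ℝ) :
    ℕ :=
  {k | k ∈ Set.Icc 1 K ∧ HoldsPosition post back R t k}.ncard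

/-- `Δ_k`: the amount of time in `[t₀, tf]` during which a post of a broadcaster in `R` is at the
`k`-th position. -/
def timeAt {V : Type*} (t₀ tf : ℝ) (post : V → Finset ℝ) (back : Finset ℝ) (R : Finset V)
    (k : ℕ) : ℝ :=
  volume.real {t | t ∈ Set.Icc t₀ tf ∧ HoldsPosition post back R t k}

/-- The broadcasters that user `j` follows due to the links in `S`. -/
def sources {V : Type*} [DecidableEq V] (S : Finset (V × V)) (j : V) : Finset V :=
  (S.filter fun e => e.2 = j).image Prod.fst

namespace Problem

variable {V : Type*} [DecidableEq V]

/-- The feeds `𝒲_{i,:}` to which broadcaster `i` has a candidate link. -/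
def walls (M : Problem V) (i : V) : Finset V :=
  (M.links.filter fun e => e.1 = i).image Prod.snd

/-- The partition matroid constraint: at most `c_i` links for each broadcaster `i`. -/
def Feasible (M : Problem V) (S : Finset (V × V)) : Prop :=
  S ⊆ M.links ∧ ∀ i ∈ M.broadcasters, (S.filter fun e => e.1 = i).card ≤ M.budget i

/-- The random posts of the model on a probability space `(Ω, P)`: `post i` are the posts of
broadcaster `i` and `back j` the posts which user `j` receives from the accounts already followed.
All of them are Poisson processes with the given intensities, and for each user `j` the processes
that can meet in the feed of `j` are independent. -/
structure IsPostModel (M : Problem V) {Ω : Type*} [MeasurableSpace Ω] (P : Measure Ω)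
    (post back : V → Ω → Finset ℝ) : Prop where
  post_poisson : ∀ i ∈ M.broadcasters, IsPoissonProcess P M.tf (M.mu i) (post i)
  back_poisson : ∀ j, IsPoissonProcess P M.tf (M.gam j) (back j)
  indep : ∀ j, iIndep
    (fun s : Option {i // (i, j) ∈ M.links} =>
      s.elim (pointSigma (back j)) fun i => pointSigma (post i.1)) P

/-- The deterministic top `K` visibility in the feed of user `j` due to the links `S`, in the
realization `ω`: the integral of `r(t)` over the observation window. -/
def pathVisibility (M : Problem V) {Ω : Type*} (post back : V → Ω → Finset ℝ)
    (S : Finset (V × V)) (j : V) (ω : Ω) : ℝ :=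
  ∫ t in M.t₀..M.tf, (topCount M.K (fun i => post i ω) (back j ω) (sources S j) t : ℝ)

/-- The (expected) visibility `U(S, j)` in the feed of user `j` due to the links `S`. -/
def visibility (M : Problem V) {Ω : Type*} [MeasurableSpace Ω] (P : Measure Ω)
    (post back : V → Ω → Finset ℝ) (S : Finset (V × V)) (j : V) : ℝ :=
  ∫ ω, M.pathVisibility post back S j ω ∂P

/-- The average visibility `F(S)`. -/
def avgVisibility [Fintype V] (M : Problem V) {Ω : Type*} [MeasurableSpace Ω] (P : Measure Ω)
    (post back : V → Ω → Finset ℝ) (S : Finset (V × V)) : ℝ :=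
  ∑ j, M.visibility P post back S j

/-- The empirical estimate of `U(S, j)` from the `n` realizations `x 0, …, x (n - 1)`. -/
def empVisibility (M : Problem V) {Ω : Type*} (post back : V → Ω → Finset ℝ) {n : ℕ}
    (x : Fin n → Ω) (S : Finset (V × V)) (j : V) : ℝ :=
  (∑ k ∈ Finset.Icc 1 M.K, ∑ l : Fin n,
    timeAt M.t₀ M.tf (fun i => post i (x l)) (back j (x l)) (sources S j) k) / n

/-- The empirical estimate of the average visibility `F(S)`. -/
def empAvgVisibility [Fintype V] (M : Problem V) {Ω : Type*} (post back : V → Ω → Finset ℝ)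
    {n : ℕ} (x : Fin n → Ω) (S : Finset (V × V)) : ℝ :=
  ∑ j, M.empVisibility post back x S j

end Problem

end LinkRec

end

namespace LinkRec

/-! ### Generalized curvature -/

/-! The usual greedy analysis with an estimated objective would need accuracy on exponentially many
sets. The point here is that only sets with at most `L = ⌈1/y⌉` links to a user matter. With `B = K
(tf - t₀)`, the final bound tolerates an error `y * B` per selected link; a user with `s ≥ L`
selected links has the allowance `y * B * s ≥ B`, which exceeds all visibility she can offer, so
nothing has to be known about her estimates. A user with no selected link contributes no error to
the value of the output either, because both visibilities of `∅` vanish. The total error thus scales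
with the budgets and not with the number of users.

Deterministic part (`greedy_approx`): by `exists_matching`, each link of a feasible `A` missed by
greedy is sent injectively to a selected link of the same broadcaster. By
`GreedyState.exists_history`, its estimated gain at the time of that selection was at most the gain
of the selected link. Generalized curvature bounds `ξ` times the true benefit of the missed links by
their true gains at those earlier times; these are within `2 * y * B` of the estimated gains, which
sum to at most the estimated value of the output.

Probabilistic part: the estimate is a mean of independent copies of a path visibility in `[0, B]`
(`sum_timeAt`), so `hoeffding_mean` applies. The visibility of `j` depends only on links to `j`, so
the union bound in `measure_compl_accurateEvent_le` runs over `L`-tuples of links, and `L` enters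
the sample size only as a factor: `Z = log 2`, `Q = 2 * y ^ 2 / L`.

Monotonicity and measurability of the visibility both rest on `lt_backCount_iff`, which expresses
feed positions by counts of posts in intervals. -/

theorem generalizedCurvature_mem {E : Type*} [DecidableEq E] {G : Finset E} {f : Finset E → ℝ}
    (hf : ∀ A B : Finset E, A ⊆ B → B ⊆ G → f A ≤ f B) :
    0 ≤ generalizedCurvature G f ∧ generalizedCurvature G f ≤ 1 ∧
      IsAlphaSubmodular G f (generalizedCurvature G f) := by
  -- The conditions on `α` are finitely or infinitely many weak linear inequalities, so the infimum
  -- is attained; monotonicity makes `1` admissible.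
  have hclosed : IsClosed {α : ℝ | 0 ≤ α ∧ α ≤ 1 ∧ IsAlphaSubmodular G f α} := by
    simp only [IsAlphaSubmodular, Set.ofPred_and, Set.ofPred_forall]
    refine isClosed_Ici.inter (isClosed_Iic.inter ?_)
    refine isClosed_iInter fun v => isClosed_iInter fun _ => isClosed_iInter fun A =>
      isClosed_iInter fun B => isClosed_iInter fun _ => isClosed_iInter fun _ => ?_
    exact isClosed_le (by fun_prop) (by fun_prop)
  refine hclosed.csInf_mem ⟨1, zero_le_one, le_rfl, fun v hv A B hAB hB => ?_⟩
    ⟨0, fun α hα => hα.1⟩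
  rw [sub_self, zero_mul]
  exact sub_nonneg.2 (hf _ _ (Finset.subset_insert _ _)
    (Finset.insert_subset hv (hAB.trans hB)))

/-! ### Runs of the greedy algorithm under a partition matroid constraint -/

section Greedy

variable {V : Type*} [DecidableEq V]

/-- A greedy run, recorded by the set `pre v` of the links selected before `v`: every link that is
not selected although it was considered belongs to a broadcaster whose budget is exhausted. -/
theorem GreedyState.exists_history {M : Problem V} {f : Finset (V × V) → ℝ}
    {S U : Finset (V × V)} (h : GreedyState M.links M.Feasible f S U) :
    S ⊆ U ∧ U ⊆ M.links ∧ M.Feasible S ∧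
      (∀ o ∈ U, o ∉ S → (S.filter fun e => e.1 = o.1).card = M.budget o.1) ∧
      ∃ pre : V × V → Finset (V × V), (∀ v ∈ S, pre v ⊆ S) ∧
        f S = f ∅ + ∑ v ∈ S, marginal f v (pre v) ∧
        (∀ o ∈ M.links, o ∉ S → ∀ v ∈ S, (o ∉ U ∨ v.1 = o.1) →
          marginal f o (pre v) ≤ marginal f v (pre v)) := by
  induction h with
  | start =>
    refine ⟨subset_rfl, Finset.empty_subset _, ⟨Finset.empty_subset _, by simp⟩, by simp,
      fun _ => ∅, by simp, by simp, by simp⟩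
  | select S U v h hv hmax hI ih =>
    obtain ⟨hSU, hU, hS, hfull, pre, hpre, hsum, hle⟩ := ih
    rw [Finset.mem_sdiff] at hv
    have hvS : v ∉ S := fun hh => hv.2 (hSU hh)
    refine ⟨Finset.insert_subset_insert _ hSU, Finset.insert_subset hv.1 hU, hI, ?_,
      Function.update pre v S, ?_, ?_, ?_⟩
    · intro o ho hoS
      rw [Finset.mem_insert, not_or] at hoS
      have hoU : o ∈ U := (Finset.mem_insert.1 ho).resolve_left hoS.1
      have := hfull o hoU hoS.2
      refine le_antisymm (hI.2 _ (M.source_mem _ (hU hoU))) (this ▸ Finset.card_le_card ?_)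
      exact Finset.filter_subset_filter _ (Finset.subset_insert _ _)
    · intro w hw
      by_cases hwv : w = v
      · subst hwv; simp
      · rw [Function.update_of_ne hwv]
        exact (hpre w ((Finset.mem_insert.1 hw).resolve_left hwv)).trans (Finset.subset_insert _ _)
    · rw [Finset.sum_insert hvS, Function.update_self]
      have : ∑ w ∈ S, marginal f w (Function.update pre v S w) = ∑ w ∈ S, marginal f w (pre w) := by
        refine Finset.sum_congr rfl fun w hw => ?_
        rw [Function.update_of_ne (fun hh : w = v => hvS (hh ▸ hw))]
      rw [this, marginal]
      linarith
    · intro o ho hoS w hw how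
      rw [Finset.mem_insert, not_or] at hoS
      by_cases hwv : w = v
      · subst hwv
        rw [Function.update_self]
        -- An `o` considered and rejected earlier would have left the budget of its broadcaster
        -- full, and then `w`, from the same broadcaster, could not be selected. Hence `o` was still
        -- a competitor.
        refine hmax o (Finset.mem_sdiff.2 ⟨ho, fun hoU => ?_⟩)
        have hwo : w.1 = o.1 := how.resolve_left fun hh => hh (Finset.mem_insert_of_mem hoU)
        have h1 := hfull o hoU hoS.2
        have h2 := hI.2 _ (M.source_mem _ ho)
        rw [Finset.filter_insert, if_pos hwo, Finset.card_insert_of_notMem (by simp [hvS])] at h2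
        omega
      · rw [Function.update_of_ne hwv]
        exact hle o ho hoS.2 w ((Finset.mem_insert.1 hw).resolve_left hwv)
          (how.imp_left fun hh hoU => hh (Finset.mem_insert_of_mem hoU))
  | discard S U v h hv hmax hI ih =>
    obtain ⟨hSU, hU, hS, hfull, pre, hpre, hsum, hle⟩ := ih
    rw [Finset.mem_sdiff] at hv
    have hvS : v ∉ S := fun hh => hv.2 (hSU hh)
    refine ⟨hSU.trans (Finset.subset_insert _ _), Finset.insert_subset hv.1 hU, hS, ?_,
      pre, hpre, hsum, ?_⟩
    · intro o ho hoS
      rcases Finset.mem_insert.1 ho with rfl | hoU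
      -- In a partition matroid, adding one link can only violate the constraint of its own
      -- broadcaster.
      · refine le_antisymm (hS.2 _ (M.source_mem _ hv.1)) (not_lt.1 fun hlt => hI
          ⟨Finset.insert_subset hv.1 hS.1, fun i hi => ?_⟩)
        rw [Finset.filter_insert]
        split_ifs with hoi
        · subst hoi
          exact (Finset.card_insert_le _ _).trans hlt
        · exact hS.2 i hi
      · exact hfull o hoU hoS
    · intro o ho hoS w hw how
      exact hle o ho hoS w hw (how.imp_left fun hh hoU => hh (Finset.mem_insert_of_mem hoU))

theorem Problem.Feasible.card_le {M : Problem V} {S : Finset (V × V)} (hS : M.Feasible S) :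
    S.card ≤ ∑ i ∈ M.broadcasters, M.budget i := by
  rw [Finset.card_eq_sum_card_fiberwise (f := Prod.fst) (t := M.broadcasters)
    fun e he => M.source_mem e (hS.1 he)]
  exact Finset.sum_le_sum fun i hi => hS.2 i hi

/-- The links of a feasible set that a greedy run discards are matched with links of the same
broadcasters that it selects. -/
theorem exists_matching {M : Problem V} {S A : Finset (V × V)} (hA : M.Feasible A)
    (hfull : ∀ o ∈ M.links, o ∉ S → (S.filter fun e => e.1 = o.1).card = M.budget o.1) :
    ∃ π : V × V → V × V, Set.InjOn π (A \ S : Finset (V × V)) ∧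
      ∀ o ∈ A \ S, π o ∈ S ∧ (π o).1 = o.1 := by
  have key : ∀ i : V, ∃ g : V × V → V × V,
      Set.InjOn g ((A \ S).filter fun e => e.1 = i : Finset (V × V)) ∧
      ∀ o ∈ A \ S, o.1 = i → g o ∈ S ∧ (g o).1 = i := by
    intro i
    by_cases hne : ((A \ S).filter fun e => e.1 = i).Nonempty
    · obtain ⟨o, ho⟩ := hne
      simp only [Finset.mem_filter, Finset.mem_sdiff] at ho
      obtain ⟨⟨hoA, hoS⟩, rfl⟩ := ho
      have hcard : ((A \ S).filter fun e => e.1 = o.1).card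
          ≤ (S.filter fun e => e.1 = o.1).card := by
        rw [hfull o (hA.1 hoA) hoS]
        exact (Finset.card_le_card (Finset.filter_subset_filter _ Finset.sdiff_subset)).trans
          (hA.2 _ (M.source_mem _ (hA.1 hoA)))
      have : Nonempty (V × V) := ⟨o⟩
      obtain ⟨g, hg, hinj⟩ := Set.Finite.exists_injOn_of_encard_le
        (Finset.finite_toSet ((A \ S).filter fun e => e.1 = o.1))
        (t := ((S.filter fun e => e.1 = o.1 : Finset (V × V)) : Set (V × V))) (by
          simpa only [Set.encard_coe_eq_coe_finsetCard, Nat.cast_le] using hcard)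
      refine ⟨g, hinj, fun p hp hpo => ?_⟩
      have : p ∈ (((A \ S).filter fun e => e.1 = o.1 : Finset (V × V)) : Set (V × V)) := by
        simpa [hpo] using hp
      simpa using hg this
    · refine ⟨id, Function.injective_id.injOn, fun o ho hoi => (hne ⟨o, ?_⟩).elim⟩
      exact Finset.mem_filter.2 ⟨ho, hoi⟩
  choose g hinj hg using key
  -- The injections for different broadcasters glue together because each preserves the source. Any
  -- injection serves, since the greedy comparison holds for every selected link of the same
  -- broadcaster.
  refine ⟨fun o => g o.1 o, fun o ho p hp hop => ?_, fun o ho => hg o.1 o ho rfl⟩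
  have h1 : (g o.1 o).1 = o.1 := (hg o.1 o ho rfl).2
  have h2 : (g p.1 p).1 = p.1 := (hg p.1 p hp rfl).2
  have hsrc : o.1 = p.1 := by rw [← h1, ← h2]; exact congrArg Prod.fst hop
  refine hinj p.1 ?_ ?_ (by simpa [hsrc] using hop)
  · exact Finset.mem_coe.2 (Finset.mem_filter.2 ⟨ho, hsrc⟩)
  · exact Finset.mem_coe.2 (Finset.mem_filter.2 ⟨hp, rfl⟩)

/-! ### The greedy guarantee for abstract visibility functions -/

/-- A visibility function: the value `u j S` of the links `S` for user `j` is nondecreasing,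
bounded by `B`, and depends only on the links in `S` to `j`. -/
structure IsVisibilityFunction (G : Finset (V × V)) (B : ℝ) (u : V → Finset (V × V) → ℝ) :
    Prop where
  mono : ∀ j A A', A ⊆ A' → A' ⊆ G → u j A ≤ u j A'
  local_links : ∀ j A, u j (A.filter fun e => e.2 = j) = u j A
  empty : ∀ j, u j ∅ = 0
  le_bound : ∀ j A, A ⊆ G → u j A ≤ B

namespace IsVisibilityFunction

variable {G : Finset (V × V)} {B : ℝ} {u : V → Finset (V × V) → ℝ}

theorem nonneg (hu : IsVisibilityFunction G B u) (j : V) {A : Finset (V × V)} (hA : A ⊆ G) :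
    0 ≤ u j A :=
  hu.empty j ▸ hu.mono j ∅ A (Finset.empty_subset _) hA

/-- A link affects only the feed it points to, so errors of a marginal gain involve two estimates of
one user, not all of them. -/
theorem marginal_sum [Fintype V] (hu : IsVisibilityFunction G B u) (o : V × V)
    (A : Finset (V × V)) : marginal (fun S => ∑ j, u j S) o A = u o.2 (insert o A) - u o.2 A := by
  rw [marginal, ← Finset.sum_sub_distrib]
  refine Finset.sum_eq_single o.2 (fun j _ hj => ?_) (fun h => (h (Finset.mem_univ _)).elim)
  rw [← hu.local_links j (insert o A), Finset.filter_insert, if_neg (Ne.symm hj), hu.local_links,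
    sub_self]

theorem sum_mono [Fintype V] (hu : IsVisibilityFunction G B u) (A A' : Finset (V × V))
    (h : A ⊆ A') (hA' : A' ⊆ G) : ∑ j, u j A ≤ ∑ j, u j A' :=
  Finset.sum_le_sum fun j _ => hu.mono j A A' h hA'

/-- The gain of a user from a set of additional links, for an approximately submodular objective. -/
theorem mul_sub_le_sum_marginal [Fintype V] (hu : IsVisibilityFunction G B u) {ξ : ℝ}
    (hsub : IsAlphaSubmodular G (fun S => ∑ j, u j S) (1 - ξ)) {S : Finset (V × V)} (hS : S ⊆ G)
    (j : V) (pre : V × V → Finset (V × V)) (D : Finset (V × V)) (hD : D ⊆ G)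
    (hDj : ∀ o ∈ D, o.2 = j) (hpre : ∀ o ∈ D, pre o ⊆ S) :
    ξ * (u j (D ∪ S) - u j S) ≤ ∑ o ∈ D, marginal (fun S => ∑ j, u j S) o (pre o) := by
  induction D using Finset.induction_on with
  | empty => simp
  | insert o D ho ih =>
    rw [Finset.sum_insert ho]
    have ih := ih ((Finset.subset_insert _ _).trans hD)
      (fun p hp => hDj p (Finset.mem_insert_of_mem hp))
      (fun p hp => hpre p (Finset.mem_insert_of_mem hp))
    have hoD := Finset.mem_insert_self o D
    have h1 := hsub o (hD hoD) (pre o) (D ∪ S)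
      ((hpre o hoD).trans Finset.subset_union_right)
      (Finset.union_subset ((Finset.subset_insert _ _).trans hD) hS)
    rw [hu.marginal_sum o (D ∪ S), sub_sub_cancel, hDj o hoD, ← Finset.insert_union] at h1
    linarith

end IsVisibilityFunction

/-- The greedy algorithm with an estimated objective, when the estimates are accurate for all users
with at most `L` new links. -/
theorem greedy_approx [Fintype V] {M : Problem V} {B y ξ : ℝ} {L : ℕ}
    {u uh : V → Finset (V × V) → ℝ} (hB : 0 ≤ B) (hy : 0 ≤ y) (hL : 1 ≤ y * L)
    (hu : IsVisibilityFunction M.links B u) (huh : IsVisibilityFunction M.links B uh)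
    (hξ : 0 ≤ ξ)
    (hsub : IsAlphaSubmodular M.links (fun S => ∑ j, u j S) (1 - ξ))
    (hacc : ∀ j A, A ⊆ M.links → (A.filter fun e => e.2 = j).card ≤ L → |uh j A - u j A| ≤ y * B)
    {S A : Finset (V × V)}
    (hS : IsGreedyOutput M.links M.Feasible (fun S => ∑ j, uh j S) S) (hA : M.Feasible A) :
    ξ * ∑ j, u j A ≤
      (1 + ξ) * (∑ j, u j S + 4 * (y * B) * ∑ i ∈ M.broadcasters, (M.budget i : ℝ)) := by
  obtain ⟨-, -, hSf, hfull, pre, hpre, hsum, hle⟩ := GreedyState.exists_history hS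
  obtain ⟨π, hinj, hπ⟩ := exists_matching hA hfull
  have hyB : 0 ≤ y * B := mul_nonneg hy hB
  have hBL : ∀ s : ℕ, L ≤ s → B ≤ y * B * s := fun s hs => by
    have h1 : y * L ≤ y * s := mul_le_mul_of_nonneg_left (by exact_mod_cast hs) hy
    nlinarith
  set s : V → ℕ := fun j => (S.filter fun e => e.2 = j).card with hs
  have hcardS : (∑ j, (s j : ℝ)) = S.card := by
    rw [Finset.card_eq_sum_card_fiberwise (f := Prod.snd) (t := Finset.univ) (by simp)]
    push_cast; rfl
  have hC : ∀ X : Finset (V × V), M.Feasible X →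
      (X.card : ℝ) ≤ ∑ i ∈ M.broadcasters, (M.budget i : ℝ) := fun X hX => by
    exact_mod_cast hX.card_le
  have hmarg : ∀ v ∈ M.links, ∀ X ⊆ M.links, 0 ≤ marginal (fun S => ∑ j, uh j S) v X :=
    fun v hv X hX => sub_nonneg.2 (huh.sum_mono _ _ (Finset.subset_insert _ _)
      (Finset.insert_subset hv hX))
  have hpreL : ∀ v ∈ S, pre v ⊆ M.links := fun v hv => (hpre v hv).trans hSf.1
  -- Three cases for each user: for `s j ≥ L` the trivial bound `B` is within the allowance, for `s
  -- j = 0` both values are `0`, and otherwise one error `y * B` is at most `y * B * s j`.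
  have hgreedy : ∑ j, uh j S ≤ ∑ j, u j S + y * B * S.card := by
    rw [← hcardS, Finset.mul_sum, ← Finset.sum_add_distrib]
    refine Finset.sum_le_sum fun j _ => ?_
    by_cases hj : L ≤ s j
    · linarith [hBL _ hj, huh.le_bound j S hSf.1, hu.nonneg j hSf.1]
    · by_cases h0 : s j = 0
      · have : S.filter (fun e => e.2 = j) = ∅ := Finset.card_eq_zero.1 h0
        rw [h0, ← hu.local_links, ← huh.local_links, this, hu.empty, huh.empty]
        simp
      · have h1 := (abs_le.1 (hacc j S hSf.1 (not_le.1 hj).le)).2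
        have h2 : (1 : ℝ) ≤ s j := by exact_mod_cast Nat.one_le_iff_ne_zero.2 h0
        nlinarith
  have huser : ∀ j, ξ * u j A ≤ ξ * u j S + ξ * (y * B * s j) +
      ∑ o ∈ (A \ S).filter (fun e => e.2 = j),
        (marginal (fun S => ∑ j, uh j S) o (pre (π o)) + 2 * (y * B)) := by
    intro j
    have hnn : ∀ o ∈ (A \ S).filter (fun e => e.2 = j),
        0 ≤ marginal (fun S => ∑ j, uh j S) o (pre (π o)) + 2 * (y * B) := by
      intro o ho
      rw [Finset.mem_filter] at ho
      have := hmarg o (hA.1 (Finset.sdiff_subset ho.1)) _ (hpreL _ (hπ o ho.1).1)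
      linarith
    by_cases hj : L ≤ s j
    · have h1 : ξ * u j A ≤ ξ * (y * B * s j) :=
        mul_le_mul_of_nonneg_left ((hu.le_bound j A hA.1).trans (hBL _ hj)) hξ
      have h2 := mul_nonneg hξ (hu.nonneg j hSf.1)
      linarith [Finset.sum_nonneg hnn]
    · set D := (A \ S).filter (fun e => e.2 = j) with hD
      have hDA : D ⊆ M.links := fun o ho =>
        hA.1 (Finset.sdiff_subset (Finset.mem_filter.1 ho).1)
      have h1 : u j A ≤ u j (D ∪ S) := by
        rw [← hu.local_links j A]
        refine hu.mono _ _ _ (fun o ho => ?_) (Finset.union_subset hDA hSf.1)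
        simp only [hD, Finset.mem_filter, Finset.mem_union, Finset.mem_sdiff] at ho ⊢
        tauto
      have h2 := hu.mul_sub_le_sum_marginal hsub hSf.1 j (fun o => pre (π o)) D hDA
        (fun o ho => (Finset.mem_filter.1 ho).2)
        (fun o ho => hpre _ (hπ o (Finset.mem_filter.1 ho).1).1)
      have h3 : ∑ o ∈ D, marginal (fun S => ∑ j, u j S) o (pre (π o)) ≤
          ∑ o ∈ D, (marginal (fun S => ∑ j, uh j S) o (pre (π o)) + 2 * (y * B)) := by
        refine Finset.sum_le_sum fun o ho => ?_
        have hoj : o.2 = j := (Finset.mem_filter.1 ho).2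
        have hπo := (hπ o (Finset.mem_filter.1 ho).1).1
        rw [hu.marginal_sum, huh.marginal_sum, hoj]
        have hsub1 : ((pre (π o)).filter fun e => e.2 = j).card ≤ s j :=
          Finset.card_le_card (Finset.filter_subset_filter _ (hpre _ hπo))
        have e1 := abs_le.1 (hacc j (pre (π o)) (hpreL _ hπo) (hsub1.trans (not_le.1 hj).le))
        -- Here `s j < L` is used strictly: one more link to `j` still leaves at most `L`.
        have e2 := abs_le.1 (hacc j (insert o (pre (π o)))
          (Finset.insert_subset (hDA ho) (hpreL _ hπo)) (by
            rw [Finset.filter_insert, if_pos hoj]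
            exact (Finset.card_insert_le _ _).trans (by omega)))
        linarith [e1.1, e1.2, e2.1, e2.2]
      have h4 := mul_le_mul_of_nonneg_left h1 hξ
      have h5 : 0 ≤ ξ * (y * B * s j) := by positivity
      linarith
  have hdisc : ∑ o ∈ A \ S, (marginal (fun S => ∑ j, uh j S) o (pre (π o)) + 2 * (y * B)) ≤
      ∑ j, uh j S + 2 * (y * B) * A.card := by
    rw [Finset.sum_add_distrib, Finset.sum_const, nsmul_eq_mul]
    have h1 : ∑ o ∈ A \ S, marginal (fun S => ∑ j, uh j S) o (pre (π o)) ≤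
        ∑ v ∈ S, marginal (fun S => ∑ j, uh j S) v (pre v) := by
      calc _ ≤ ∑ o ∈ A \ S, marginal (fun S => ∑ j, uh j S) (π o) (pre (π o)) :=
            Finset.sum_le_sum fun o ho => hle o (hA.1 (Finset.sdiff_subset ho))
              (Finset.mem_sdiff.1 ho).2 _ (hπ o ho).1 (Or.inr (hπ o ho).2)
        _ = ∑ v ∈ (A \ S).image π, marginal (fun S => ∑ j, uh j S) v (pre v) :=
            (Finset.sum_image (f := fun v => marginal (fun S => ∑ j, uh j S) v (pre v)) hinj).symm
        _ ≤ _ := Finset.sum_le_sum_of_subset_of_nonneg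
            (Finset.image_subset_iff.2 fun o ho => (hπ o ho).1)
            fun v hv _ => hmarg v (hSf.1 hv) _ (hpreL v hv)
    have h2 : ((A \ S).card : ℝ) ≤ A.card := by
      exact_mod_cast Finset.card_le_card Finset.sdiff_subset
    simp only [huh.empty, Finset.sum_const_zero, zero_add] at hsum
    nlinarith
  have htotal := Finset.sum_le_sum fun j (_ : j ∈ Finset.univ) => huser j
  rw [Finset.sum_add_distrib, Finset.sum_add_distrib, ← Finset.mul_sum, ← Finset.mul_sum,
    ← Finset.mul_sum, ← Finset.mul_sum, hcardS,
    Finset.sum_fiberwise (A \ S) Prod.snd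
      (fun o => marginal (fun S => ∑ j, uh j S) o (pre (π o)) + 2 * (y * B))] at htotal
  -- The errors add up to at most `(3 + ξ) * y * B * C`, and `3 + ξ ≤ 4 * (1 + ξ)`.
  set C := ∑ i ∈ M.broadcasters, (M.budget i : ℝ)
  have c1 := mul_le_mul_of_nonneg_left (hC S hSf) hyB
  have c2 := mul_le_mul_of_nonneg_left (hC A hA) hyB
  have c3 := mul_le_mul_of_nonneg_left c1 hξ
  have c4 : 0 ≤ y * B * C := mul_nonneg hyB ((Nat.cast_nonneg _).trans (hC A hA))
  have c5 := mul_nonneg hξ c4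
  linarith

end Greedy

end LinkRec
namespace LinkRec

/-! ### Counts in sorted lists of flagged times -/

section Lists

/-- The number of entries with flag `b` and time at least `s`. -/
noncomputable def countSince (b : Bool) (s : ℝ) (l : List (ℝ ×ₗ Bool)) : ℕ :=
  l.countP fun p => (ofLex p).2 = b ∧ s ≤ (ofLex p).1

theorem countSince_cons (b : Bool) (s : ℝ) (a : ℝ ×ₗ Bool) (l : List (ℝ ×ₗ Bool)) :
    countSince b s (a :: l) =
      countSince b s l + if (ofLex a).2 = b ∧ s ≤ (ofLex a).1 then 1 else 0 := by
  simp [countSince, List.countP_cons]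

/-- In a list in decreasing order, the number of background entries among the first `K` ones. -/
theorem lt_countP_take_iff {l : List (ℝ ×ₗ Bool)} (hl : l.Pairwise (· ≥ ·)) (K g : ℕ) :
    g + 1 ≤ (l.take K).countP (fun p => (ofLex p).2 = false) ↔
      ∃ s : ℝ, g + 1 ≤ countSince false s l ∧ g + 1 + countSince true s l ≤ K := by
  induction l generalizing K g with
  | nil => simp [countSince]
  | cons a l ih =>
    obtain ⟨hal, hl⟩ := List.pairwise_cons.1 hl
    have htime : ∀ p ∈ l, (ofLex p).1 ≤ (ofLex a).1 := fun p hp => by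
      rcases Prod.Lex.le_iff.1 (hal p hp) with h | h
      · exact h.le
      · exact h.1.le
    cases K with
    | zero => simp
    | succ K =>
      rw [List.take_succ_cons, List.countP_cons]
      rcases hflag : (ofLex a).2 with _ | _
      · cases g with
        | zero =>
          refine iff_of_true (by simp) ⟨(ofLex a).1, ?_, ?_⟩
          · simp [countSince, hflag]
          -- For equal times the lexicographic order puts flag `true` first, so no `true` entry at
          -- the time of `a` can follow it.
          · have : countSince true (ofLex a).1 (a :: l) = 0 := by
              refine List.countP_eq_zero.2 fun p hp => ?_
              rcases List.mem_cons.1 hp with rfl | hp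
              · simp [hflag]
              · rcases Prod.Lex.le_iff.1 (hal p hp) with h | h
                · simp [h]
                · have := h.2
                  rw [hflag] at this
                  simp [Bool.eq_false_of_le_false this]
            omega
        | succ g =>
          have ih := ih hl K g
          simp only [decide_true, if_true]
          rw [Nat.add_le_add_iff_right, ih]
          constructor
          · rintro ⟨s, h1, h2⟩
            have hs : s ≤ (ofLex a).1 := by
              obtain ⟨p, hp, hps⟩ := List.countP_pos_iff.1 (Nat.lt_of_lt_of_le g.succ_pos h1)
              simp only [decide_eq_true_eq] at hps
              exact hps.2.trans (htime p hp)
            refine ⟨s, ?_, ?_⟩ <;> simp only [countSince_cons, hflag, hs] <;> simp <;> omega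
          · rintro ⟨s, h1, h2⟩
            simp only [countSince_cons, hflag] at h1 h2
            refine ⟨s, ?_, ?_⟩
            · split_ifs at h1 <;> omega
            · simp at h2; omega
      · have ih := ih hl K g
        simp only [Bool.true_eq_false, decide_false, Bool.false_eq_true, if_false, add_zero]
        rw [ih]
        constructor
        · rintro ⟨s, h1, h2⟩
          refine ⟨s, ?_, ?_⟩ <;> simp only [countSince_cons, hflag]
          · simpa using h1
          · split_ifs <;> omega
        · rintro ⟨s, h1, h2⟩
          have hs : s ≤ (ofLex a).1 := by
            obtain ⟨p, hp, hps⟩ := List.countP_pos_iff.1 (Nat.lt_of_lt_of_le g.succ_pos h1)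
            simp only [decide_eq_true_eq] at hps
            rcases List.mem_cons.1 hp with rfl | hp
            · exact hps.2
            · exact hps.2.trans (htime p hp)
          simp only [countSince_cons, hflag, hs] at h1 h2
          simp at h1 h2
          exact ⟨s, h1, by omega⟩

/-- Finitely many times leave a gap just below `s`, which contains a rational. This makes thresholds
countable, as measurability requires. -/
theorem exists_rat_forall_le_iff (l : List ℝ) (s : ℝ) :
    ∃ q : ℚ, (q : ℝ) < s ∧ ∀ a ∈ l, s ≤ a ↔ (q : ℝ) ≤ a := by
  suffices h : ∃ r < s, ∀ a ∈ l, s ≤ a ∨ a ≤ r by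
    obtain ⟨r, hr, h⟩ := h
    obtain ⟨q, hq1, hq2⟩ := exists_rat_btwn hr
    refine ⟨q, hq2, fun a ha => ⟨fun h1 => hq2.le.trans h1, fun h1 => ?_⟩⟩
    exact (h a ha).resolve_right fun h2 => absurd (h1.trans h2) (not_le.2 hq1)
  induction l with
  | nil => exact ⟨s - 1, by linarith, by simp⟩
  | cons a l ih =>
    obtain ⟨r, hr, h⟩ := ih
    by_cases ha : s ≤ a
    · exact ⟨r, hr, List.forall_mem_cons.2 ⟨Or.inl ha, h⟩⟩
    · refine ⟨max r a, max_lt hr (not_le.1 ha), List.forall_mem_cons.2 ⟨Or.inr (le_max_right _ _),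
        fun b hb => (h b hb).imp_right fun hh => hh.trans (le_max_left _ _)⟩⟩

theorem lt_countP_take_iff_rat {l : List (ℝ ×ₗ Bool)} (hl : l.Pairwise (· ≥ ·)) (K g : ℕ) :
    g + 1 ≤ (l.take K).countP (fun p => (ofLex p).2 = false) ↔
      ∃ q : ℚ, g + 1 ≤ countSince false q l ∧ g + 1 + countSince true q l ≤ K := by
  rw [lt_countP_take_iff hl]
  refine ⟨fun ⟨s, h⟩ => ?_, fun ⟨q, h⟩ => ⟨q, h⟩⟩
  obtain ⟨q, -, hq⟩ := exists_rat_forall_le_iff (l.map fun p => (ofLex p).1) s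
  have : ∀ b, countSince b s l = countSince b q l := fun b => by
    refine List.countP_congr fun p hp => ?_
    simp only [decide_eq_true_eq, hq _ (List.mem_map_of_mem hp)]
  exact ⟨q, by rwa [← this, ← this]⟩

theorem countP_true_add_countP_false (l : List (ℝ ×ₗ Bool)) :
    l.countP (fun p => (ofLex p).2 = true) + l.countP (fun p => (ofLex p).2 = false)
      = l.length := by
  rw [List.length_eq_countP_add_countP (fun p : ℝ ×ₗ Bool => (ofLex p).2 = true)]
  congr 2
  ext p
  simp

end Lists

/-! ### The feed in terms of counts -/

section Feed

variable {V : Type*} (post : V → Finset ℝ) (back : Finset ℝ) (R : Finset V)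

theorem countIn_eq_card_filter (s : Finset ℝ) (A : Set ℝ) [DecidablePred (· ∈ A)] :
    countIn s A = (s.filter (· ∈ A)).card := by
  rw [countIn, ← Set.ncard_coe_finset]
  congr 1
  ext; simp

theorem pairwise_feed (t : ℝ) : (feed post back R t).Pairwise (· ≥ ·) :=
  Multiset.pairwise_sort _ _

/-- The number of posts of the broadcasters in `R` during `A`. -/
noncomputable def countPosts (A : Set ℝ) : ℕ := ∑ i ∈ R, countIn (post i) A

/-- Counting ignores the order, so the sort in `feed` disappears and only the point processes
remain. -/
theorem countP_feed (t : ℝ) (p : ℝ ×ₗ Bool → Prop) [DecidablePred p] :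
    (feed post back R t).countP p =
      countPosts post R {τ | τ ≤ t ∧ p (toLex (τ, true))} +
        countIn back {τ | τ ≤ t ∧ p (toLex (τ, false))} := by
  classical
  rw [← Multiset.coe_countP, feed, Multiset.sort_eq, Multiset.countP_filter, Multiset.countP_add]
  congr 1
  · rw [countPosts, ← Multiset.coe_countPAddMonoidHom, map_sum]
    refine Finset.sum_congr rfl fun i _ => ?_
    rw [Multiset.coe_countPAddMonoidHom, Multiset.countP_map, countIn_eq_card_filter,
      Finset.card_def, Finset.filter_val]
    simp [and_comm]
  · rw [Multiset.countP_map, countIn_eq_card_filter, Finset.card_def, Finset.filter_val]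
    simp [and_comm]

theorem countSince_false_feed (s t : ℝ) :
    countSince false s (feed post back R t) = countIn back (Set.Ici s ∩ Set.Iic t) := by
  rw [countSince, countP_feed]
  simp [countPosts, countIn, Set.inter_def, and_comm]

theorem countSince_true_feed (s t : ℝ) :
    countSince true s (feed post back R t) = countPosts post R (Set.Ici s ∩ Set.Iic t) := by
  rw [countSince, countP_feed]
  simp [countPosts, countIn, Set.inter_def, and_comm]

theorem length_feed (t : ℝ) :
    (feed post back R t).length =
      countPosts post R (Set.univ ∩ Set.Iic t) + countIn back (Set.univ ∩ Set.Iic t) := by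
  have h := countP_feed post back R t (fun _ => True)
  simpa [Set.Iic] using h

/-- The number of background posts among the top `K` positions of the feed. -/
noncomputable def backCount (K : ℕ) (t : ℝ) : ℕ :=
  ((feed post back R t).take K).countP fun p => (ofLex p).2 = false

theorem lt_backCount_iff (K : ℕ) (t : ℝ) (g : ℕ) :
    g + 1 ≤ backCount post back R K t ↔
      ∃ q : ℚ, g + 1 ≤ countIn back (Set.Ici (q : ℝ) ∩ Set.Iic t) ∧
        g + 1 + countPosts post R (Set.Ici (q : ℝ) ∩ Set.Iic t) ≤ K := by
  simp only [← countSince_false_feed post back R, ← countSince_true_feed post back R]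
  exact lt_countP_take_iff_rat (pairwise_feed post back R t) K g

theorem topCount_zero (t : ℝ) : topCount 0 post back R t = 0 := by
  simp [topCount]

open Classical in
theorem topCount_succ (K : ℕ) (t : ℝ) : topCount (K + 1) post back R t =
    topCount K post back R t + if HoldsPosition post back R t (K + 1) then 1 else 0 := by
  have hfin : {k | k ∈ Set.Icc 1 K ∧ HoldsPosition post back R t k}.Finite :=
    (Set.finite_Icc 1 K).subset fun k hk => hk.1
  split_ifs with h
  · rw [topCount, topCount, ← Set.ncard_insert_of_notMem (a := K + 1) (by simp) hfin]
    congr 1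
    ext k
    simp only [Set.mem_Icc, Set.mem_ofPred_eq, Set.mem_insert_iff]
    refine ⟨fun hk => ?_, ?_⟩
    · by_cases hkK : k = K + 1
      · exact Or.inl hkK
      · exact Or.inr ⟨by omega, hk.2⟩
    · rintro (rfl | hk)
      · exact ⟨by omega, h⟩
      · exact ⟨by omega, hk.2⟩
  · rw [topCount, topCount, add_zero]
    congr 1
    ext k
    simp only [Set.mem_Icc, Set.mem_ofPred_eq]
    refine ⟨fun hk => ⟨⟨hk.1.1, ?_⟩, hk.2⟩, fun hk => ⟨by omega, hk.2⟩⟩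
    have : k ≠ K + 1 := fun hh => h (hh ▸ hk.2)
    omega

theorem topCount_eq_countP (K : ℕ) (t : ℝ) : topCount K post back R t =
    ((feed post back R t).take K).countP fun p => (ofLex p).2 = true := by
  classical
  induction K with
  | zero => simp [topCount_zero]
  | succ K ih =>
    rw [topCount_succ, ih, List.take_add_one, List.countP_append]
    congr 1
    rw [HoldsPosition, Nat.add_sub_cancel]
    rcases h : (feed post back R t)[K]? with _ | p
    · simp
    · have : (∃ τ : ℝ, p = toLex (τ, true)) ↔ (ofLex p).2 = true := by
        refine ⟨?_, fun hp => ⟨(ofLex p).1, ?_⟩⟩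
        · rintro ⟨τ, rfl⟩; rfl
        · rw [← hp]; rfl
      simp [this, List.countP_cons]

/-- Each occupied top position carries one of the two flags. Facts about `backCount`, which has a
threshold description, thereby transfer to `topCount`. -/
theorem topCount_add_backCount (K : ℕ) (t : ℝ) :
    topCount K post back R t + backCount post back R K t =
      min K (countPosts post R (Set.univ ∩ Set.Iic t) + countIn back (Set.univ ∩ Set.Iic t)) := by
  rw [topCount_eq_countP, backCount, countP_true_add_countP_false, List.length_take, length_feed]

theorem topCount_le (K : ℕ) (t : ℝ) : topCount K post back R t ≤ K := by
  have := topCount_add_backCount post back R K t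
  omega

theorem topCount_empty (K : ℕ) (t : ℝ) : topCount K post back ∅ t = 0 := by
  rw [topCount_eq_countP]
  refine Nat.le_zero.1 (((List.take_sublist _ _).countP_le).trans (le_of_eq ?_))
  rw [countP_feed]
  simp [countPosts, countIn]

variable {R} in
-- Additional posts can only push background posts out of the top `K`, while the number of occupied
-- positions does not decrease.
theorem topCount_mono {R' : Finset V} (h : R ⊆ R') (K : ℕ) (t : ℝ) :
    topCount K post back R t ≤ topCount K post back R' t := by
  have hposts : ∀ A, countPosts post R A ≤ countPosts post R' A := fun A =>
    Finset.sum_le_sum_of_subset h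
  have hback : backCount post back R' K t ≤ backCount post back R K t := by
    rcases hb : backCount post back R' K t with _ | g
    · exact Nat.zero_le _
    · obtain ⟨q, h1, h2⟩ := (lt_backCount_iff post back R' K t g).1 hb.ge
      refine (lt_backCount_iff post back R K t g).2 ⟨q, h1, ?_⟩
      have := hposts (Set.Ici (q : ℝ) ∩ Set.Iic t)
      omega
  have h1 := topCount_add_backCount post back R K t
  have h2 := topCount_add_backCount post back R' K t
  have h3 := hposts (Set.univ ∩ Set.Iic t)
  omega

end Feed

/-! ### Joint measurability in the realization and in time -/

section Measurability

theorem measurable_nat_of_lt {α : Type*} [MeasurableSpace α] {f : α → ℕ}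
    (h : ∀ g, MeasurableSet {a | g + 1 ≤ f a}) : Measurable f :=
  measurable_of_Ioi fun g => h g

/-- Right continuity of the counting function in `t`, along rationals; the gap lemma is applied to
the negated times. -/
theorem le_countIn_Iic_iff (N : Finset ℝ) (A : Set ℝ) (t : ℝ) (g : ℕ) :
    g ≤ countIn N (A ∩ Set.Iic t) ↔
      ∀ q : ℚ, t < q → g ≤ countIn N (A ∩ Set.Iic (q : ℝ)) := by
  have hmono : ∀ {B B' : Set ℝ}, B ⊆ B' → countIn N B ≤ countIn N B' := fun h =>
    Set.ncard_le_ncard (Set.inter_subset_inter_right _ h) (N.finite_toSet.inter_of_left _)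
  refine ⟨fun h q hq => h.trans (hmono ?_), fun h => ?_⟩
  · exact Set.inter_subset_inter_right _ (Set.Iic_subset_Iic.2 hq.le)
  · obtain ⟨q, hq1, hq⟩ := exists_rat_forall_le_iff (N.toList.map Neg.neg) (-t)
    have := h (-q) (by push_cast; linarith)
    rw [countIn] at this ⊢
    refine this.trans_eq (congrArg Set.ncard ?_)
    ext a
    simp only [Set.mem_inter_iff, Set.mem_Iic]
    refine and_congr_right fun ha => and_congr_right fun _ => ?_
    have := hq (-a) (List.mem_map_of_mem (Finset.mem_toList.2 ha))
    push_cast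
    rw [neg_le_neg_iff, le_neg] at this
    exact this.symm

variable {Ω : Type*} [MeasurableSpace Ω]

theorem measurable_countIn_Iic {N : Ω → Finset ℝ}
    (hN : ∀ A, MeasurableSet A → Measurable fun ω => countIn (N ω) A) {A : Set ℝ}
    (hA : MeasurableSet A) : Measurable fun z : Ω × ℝ => countIn (N z.1) (A ∩ Set.Iic z.2) := by
  refine measurable_nat_of_lt fun g => ?_
  have : {z : Ω × ℝ | g + 1 ≤ countIn (N z.1) (A ∩ Set.Iic z.2)} = ⋂ q : ℚ,
      ({z : Ω × ℝ | z.2 < q}ᶜ ∪ {z | g + 1 ≤ countIn (N z.1) (A ∩ Set.Iic (q : ℝ))}) := by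
    ext z
    rw [Set.mem_ofPred_eq, le_countIn_Iic_iff]
    simp only [Set.mem_iInter, Set.mem_union, Set.mem_compl_iff, Set.mem_ofPred_eq,
      imp_iff_not_or]
  rw [this]
  refine MeasurableSet.iInter fun q => ?_
  refine (measurableSet_lt measurable_snd measurable_const).compl.union ?_
  exact measurableSet_le measurable_const ((hN _ (hA.inter measurableSet_Iic)).comp measurable_fst)

theorem measurable_topCount {V : Type*} (K : ℕ) {post : V → Ω → Finset ℝ} {back : Ω → Finset ℝ}
    {R : Finset V}
    (hpost : ∀ i ∈ R, ∀ A, MeasurableSet A → Measurable fun ω => countIn (post i ω) A)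
    (hback : ∀ A, MeasurableSet A → Measurable fun ω => countIn (back ω) A) :
    Measurable fun z : Ω × ℝ => topCount K (fun i => post i z.1) (back z.1) R z.2 := by
  have hposts : ∀ A, MeasurableSet A → Measurable fun z : Ω × ℝ =>
      countPosts (fun i => post i z.1) R (A ∩ Set.Iic z.2) := fun A hA =>
    Finset.measurable_fun_sum _ fun i hi => measurable_countIn_Iic (hpost i hi) hA
  have hbackCount : Measurable fun z : Ω × ℝ =>
      backCount (fun i => post i z.1) (back z.1) R K z.2 := by
    refine measurable_nat_of_lt fun g => ?_
    simp only [lt_backCount_iff, Set.ofPred_exists]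
    refine MeasurableSet.iUnion fun q => ?_
    exact (measurableSet_le measurable_const (measurable_countIn_Iic hback measurableSet_Ici)).inter
      (measurableSet_le (measurable_const.add (hposts _ measurableSet_Ici)) measurable_const)
  have : (fun z : Ω × ℝ => topCount K (fun i => post i z.1) (back z.1) R z.2) = fun z =>
      min K (countPosts (fun i => post i z.1) R (Set.univ ∩ Set.Iic z.2) +
        countIn (back z.1) (Set.univ ∩ Set.Iic z.2)) -
      backCount (fun i => post i z.1) (back z.1) R K z.2 := by
    ext z
    rw [← topCount_add_backCount, Nat.add_sub_cancel]
  rw [this]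
  exact (measurable_const.min ((hposts _ MeasurableSet.univ).add
    (measurable_countIn_Iic hback MeasurableSet.univ))).sub hbackCount

theorem measurable_topCount_time {V : Type*} (K : ℕ) (post : V → Finset ℝ) (back : Finset ℝ)
    (R : Finset V) : Measurable fun t => topCount K post back R t := by
  have h := measurable_topCount (Ω := Unit) (R := R) K (post := fun i _ => post i)
    (back := fun _ => back) (fun _ _ _ _ => measurable_const) (fun _ _ => measurable_const)
  have h' : Measurable fun t : ℝ => ((), t) := by fun_prop
  have := h.comp h'
  simp only [Function.comp_def] at this
  exact this

theorem measurableSet_holdsPosition {V : Type*} (post : V → Finset ℝ) (back : Finset ℝ)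
    (R : Finset V) (k : ℕ) : MeasurableSet {t | HoldsPosition post back R t (k + 1)} := by
  classical
  -- Position `k + 1` is held exactly when enlarging the top by one position raises the count.
  have : {t | HoldsPosition post back R t (k + 1)} =
      {t | topCount k post back R t < topCount (k + 1) post back R t} := by
    ext t
    simp only [Set.mem_ofPred_eq, topCount_succ]
    split_ifs with h <;> simp [h]
  rw [this]
  exact measurableSet_lt (measurable_topCount_time _ _ _ _) (measurable_topCount_time _ _ _ _)

end Measurability

/-! ### Integrated visibilities -/

section PathVisibility

variable {V : Type*} (post : V → Finset ℝ) (back : Finset ℝ) (R : Finset V)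

theorem integrableOn_topCount (K : ℕ) (a b : ℝ) :
    IntegrableOn (fun t => (topCount K post back R t : ℝ)) (Set.Icc a b) := by
  refine Measure.integrableOn_of_bounded (M := K) (by simp) ?_ (ae_of_all _ fun t => ?_)
  · exact (measurable_from_top.comp (measurable_topCount_time K post back R)).aestronglyMeasurable
  · rw [Real.norm_natCast]
    exact_mod_cast topCount_le post back R K t

theorem sum_timeAt (K : ℕ) (a b : ℝ) : ∑ k ∈ Finset.Icc 1 K, timeAt a b post back R k =
    ∫ t in Set.Icc a b, (topCount K post back R t : ℝ) := by
  classical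
  induction K with
  | zero => simp [topCount_zero]
  | succ K ih =>
    rw [Finset.sum_Icc_succ_top (by omega), ih]
    have hm := measurableSet_holdsPosition post back R K
    have : ∀ t, (topCount (K + 1) post back R t : ℝ) = topCount K post back R t +
        {t | HoldsPosition post back R t (K + 1)}.indicator (1 : ℝ → ℝ) t := fun t => by
      rw [topCount_succ]
      by_cases h : HoldsPosition post back R t (K + 1) <;> simp [h]
    simp only [this]
    have hi : IntegrableOn ({t | HoldsPosition post back R t (K + 1)}.indicator (1 : ℝ → ℝ))
        (Set.Icc a b) := IntegrableOn.indicator (integrableOn_const (by simp) (by simp)) hm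
    rw [integral_add (integrableOn_topCount post back R K a b) hi,
      integral_indicator_one hm, measureReal_restrict_apply hm, timeAt]
    congr 2
    rw [Set.inter_comm]; rfl

end PathVisibility

end LinkRec
namespace LinkRec

/-! ### Hoeffding's inequality for empirical means -/

section Hoeffding

variable {Ω : Type*} [MeasurableSpace Ω] {P : Measure Ω} [IsProbabilityMeasure P]

theorem hoeffding_upper {X : Ω → ℝ} (hX : Measurable X) {a b : ℝ} (hab : a < b)
    (hXab : ∀ ω, X ω ∈ Set.Icc a b) {y : ℝ} (hy : 0 ≤ y) (n : ℕ) :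
    (Measure.pi fun _ : Fin n => P).real {x | n * (y * (b - a)) ≤ ∑ l, (X (x l) - ∫ ω, X ω ∂P)}
      ≤ Real.exp (-2 * y ^ 2 * n) := by
  have hind := iIndepFun_pi (Ω := fun _ : Fin n => Ω) (μ := fun _ => P)
    (X := fun _ ω => X ω - ∫ ω, X ω ∂P) fun _ => (hX.sub_const _).aemeasurable
  have hsub := hasSubgaussianMGF_of_mem_Icc (μ := P) hX.aemeasurable (ae_of_all _ hXab)
  have h := HasSubgaussianMGF.measure_sum_ge_le_of_iIndepFun hind (s := Finset.univ)
    (c := fun _ => (‖b - a‖₊ / 2) ^ 2) (fun l _ => by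
      refine HasSubgaussianMGF.of_map (X := fun ω => X ω - ∫ ω, X ω ∂P)
        (Y := fun x : Fin n → Ω => x l) (measurable_pi_apply l).aemeasurable ?_
      rwa [(measurePreserving_eval (fun _ : Fin n => P) l).map_eq])
    (ε := n * (y * (b - a))) (by have := sub_nonneg.2 hab.le; positivity)
  -- With sub-Gaussian parameter `((b - a) / 2) ^ 2` for each summand, the exponent is `-(n y (b -
  -- a))² / (2 n (b - a)² / 4) = -2 y² n`.
  refine h.trans (Real.exp_le_exp.2 (le_of_eq ?_))
  have hb : (b - a) ≠ 0 := (sub_pos.2 hab).ne'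
  rcases Nat.eq_zero_or_pos n with rfl | hn
  · simp
  · have hn' : (n : ℝ) ≠ 0 := by positivity
    simp only [Finset.sum_const, Finset.card_univ, Fintype.card_fin, nsmul_eq_mul]
    push_cast
    rw [Real.norm_of_nonneg (sub_nonneg.2 hab.le)]
    field_simp

theorem hoeffding_mean {X : Ω → ℝ} (hX : Measurable X) {B : ℝ} (hB : 0 ≤ B)
    (hXB : ∀ ω, X ω ∈ Set.Icc 0 B) {y : ℝ} (hy : 0 ≤ y) (n : ℕ) :
    (Measure.pi fun _ : Fin n => P).real {x | y * B < |(∑ l, X (x l)) / n - ∫ ω, X ω ∂P|}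
      ≤ 2 * Real.exp (-2 * y ^ 2 * n) := by
  rcases Nat.eq_zero_or_pos n with rfl | hn
  -- For `n = 0` the bound is `2`.
  · refine measureReal_le_one.trans ?_
    norm_num
  rcases hB.eq_or_lt with rfl | hB
  · have h0 : ∀ ω, X ω = 0 := fun ω => le_antisymm (hXB ω).2 (hXB ω).1
    simp only [h0]
    simp only [mul_zero, Finset.sum_const_zero, zero_div, integral_zero, sub_self, abs_zero,
      lt_self_iff_false, Set.ofPred_false, measureReal_empty]
    positivity
  have hn' : (0 : ℝ) < n := by exact_mod_cast hn
  have h1 := hoeffding_upper (P := P) hX hB hXB hy n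
  have h2 := hoeffding_upper (P := P) (X := fun ω => -X ω) hX.neg (a := -B) (b := 0)
    (by linarith) (fun ω => ⟨neg_le_neg (hXB ω).2, neg_nonpos.2 (hXB ω).1⟩) hy n
  rw [two_mul]
  refine (measureReal_mono (fun x hx => ?_)).trans
    ((measureReal_union_le _ _).trans (add_le_add h1 h2))
  rw [Set.mem_ofPred_eq, lt_abs] at hx
  simp only [Set.mem_union, Set.mem_ofPred_eq, integral_neg, Finset.sum_sub_distrib,
    Finset.sum_const, Finset.card_univ, Fintype.card_fin, nsmul_eq_mul, Finset.sum_neg_distrib]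
  refine hx.imp (fun h => ?_) (fun h => ?_)
  · rw [lt_sub_iff_add_lt, lt_div_iff₀ hn'] at h
    linarith
  · rw [neg_sub, lt_sub_iff_add_lt, ← lt_sub_iff_add_lt', div_lt_iff₀ hn'] at h
    linarith

end Hoeffding

/-! ### Visibilities -/

section Visibility

variable {V : Type*} [DecidableEq V]

theorem sources_mono {S S' : Finset (V × V)} (h : S ⊆ S') (j : V) : sources S j ⊆ sources S' j :=
  Finset.image_subset_image (Finset.filter_subset_filter _ h)

theorem sources_filter (S : Finset (V × V)) (j : V) :
    sources (S.filter fun e => e.2 = j) j = sources S j := by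
  rw [sources, sources, Finset.filter_filter]
  simp

theorem sources_empty (j : V) : sources ∅ j = ∅ := by
  simp [sources]

namespace Problem

variable (M : Problem V) {Ω : Type*} {post back : V → Ω → Finset ℝ}

/-- The visibility that a user offers if all top positions are held during the whole window. -/
def maxVisibility : ℝ := M.K * (M.tf - M.t₀)

omit [DecidableEq V] in
theorem maxVisibility_nonneg : 0 ≤ M.maxVisibility :=
  mul_nonneg (Nat.cast_nonneg _) (sub_nonneg.2 M.t₀_le_tf)

theorem pathVisibility_eq (S : Finset (V × V)) (j : V) (ω : Ω) :
    M.pathVisibility post back S j ω =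
      ∫ t in Set.Icc M.t₀ M.tf, (topCount M.K (fun i => post i ω) (back j ω) (sources S j) t : ℝ) := by
  rw [pathVisibility, intervalIntegral.integral_of_le M.t₀_le_tf, integral_Icc_eq_integral_Ioc]

theorem pathVisibility_mono {S S' : Finset (V × V)} (h : S ⊆ S') (j : V) (ω : Ω) :
    M.pathVisibility post back S j ω ≤ M.pathVisibility post back S' j ω := by
  rw [pathVisibility_eq, pathVisibility_eq]
  refine integral_mono (integrableOn_topCount _ _ _ _ _ _) (integrableOn_topCount _ _ _ _ _ _)
    fun t => ?_
  exact Nat.cast_le.2 (topCount_mono _ _ (sources_mono h j) _ _)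

theorem pathVisibility_filter (S : Finset (V × V)) (j : V) (ω : Ω) :
    M.pathVisibility post back (S.filter fun e => e.2 = j) j ω =
      M.pathVisibility post back S j ω := by
  rw [pathVisibility, pathVisibility, sources_filter]

theorem pathVisibility_empty (j : V) (ω : Ω) : M.pathVisibility post back ∅ j ω = 0 := by
  simp [pathVisibility, sources_empty, topCount_empty]

theorem pathVisibility_mem_Icc (S : Finset (V × V)) (j : V) (ω : Ω) :
    M.pathVisibility post back S j ω ∈ Set.Icc 0 M.maxVisibility := by
  refine ⟨M.pathVisibility_empty (post := post) (back := back) j ω ▸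
    M.pathVisibility_mono (Finset.empty_subset S) j ω, ?_⟩
  rw [pathVisibility_eq]
  refine (integral_mono (integrableOn_topCount _ _ _ _ _ _)
    (g := fun _ => (M.K : ℝ)) (by simp) fun t => ?_).trans (le_of_eq ?_)
  · exact Nat.cast_le.2 (topCount_le _ _ _ _ _)
  · rw [setIntegral_const, Real.volume_real_Icc_of_le M.t₀_le_tf, smul_eq_mul, mul_comm,
      maxVisibility]

theorem empVisibility_eq {n : ℕ} (x : Fin n → Ω) (S : Finset (V × V)) (j : V) :
    M.empVisibility post back x S j = (∑ l, M.pathVisibility post back S j (x l)) / n := by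
  rw [empVisibility, Finset.sum_comm]
  simp only [sum_timeAt, pathVisibility_eq]

theorem isVisibilityFunction_empVisibility {n : ℕ} (x : Fin n → Ω) :
    IsVisibilityFunction M.links M.maxVisibility (fun j S => M.empVisibility post back x S j) where
  mono j A A' h _ := by
    simp only [empVisibility_eq]
    gcongr with l
    exact M.pathVisibility_mono h j _
  local_links j A := by simp only [empVisibility_eq, pathVisibility_filter]
  empty j := by simp [empVisibility_eq, pathVisibility_empty]
  le_bound j A _ := by
    simp only [empVisibility_eq]
    -- This form of the division bound covers `n = 0`, where the quotient is `0`.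
    refine div_le_of_le_mul₀ (Nat.cast_nonneg _) M.maxVisibility_nonneg ?_
    refine (Finset.sum_le_card_nsmul _ _ _ fun l _ =>
      (M.pathVisibility_mem_Icc A j (x l)).2).trans (le_of_eq ?_)
    simp [mul_comm]

variable {M} [MeasurableSpace Ω] {P : Measure Ω}

theorem measurable_pathVisibility (hM : M.IsPostModel P post back) {S : Finset (V × V)}
    (hS : S ⊆ M.links) (j : V) : Measurable (M.pathVisibility post back S j) := by
  have h : Measurable fun z : Ω × ℝ =>
      (topCount M.K (fun i => post i z.1) (back j z.1) (sources S j) z.2 : ℝ) := by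
    refine measurable_from_top.comp (measurable_topCount M.K (fun i hi => ?_)
      (hM.back_poisson j).measurable_count)
    obtain ⟨e, he, rfl⟩ := Finset.mem_image.1 hi
    exact (hM.post_poisson _ (M.source_mem e (hS (Finset.mem_filter.1 he).1))).measurable_count
  have h' := h.stronglyMeasurable.integral_prod_right' (ν := volume.restrict (Set.Icc M.t₀ M.tf))
  have : M.pathVisibility post back S j = _ := funext fun ω => M.pathVisibility_eq S j ω
  rw [this]
  exact h'.measurable

variable [IsProbabilityMeasure P]

theorem integrable_pathVisibility (hM : M.IsPostModel P post back) {S : Finset (V × V)}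
    (hS : S ⊆ M.links) (j : V) : Integrable (M.pathVisibility post back S j) P :=
  Integrable.of_mem_Icc 0 M.maxVisibility (measurable_pathVisibility hM hS j).aemeasurable
    (ae_of_all _ (M.pathVisibility_mem_Icc S j))

theorem isVisibilityFunction_visibility (hM : M.IsPostModel P post back) :
    IsVisibilityFunction M.links M.maxVisibility (fun j S => M.visibility P post back S j) where
  mono j A A' h hA' := integral_mono (integrable_pathVisibility hM (h.trans hA') j)
    (integrable_pathVisibility hM hA' j) fun ω => M.pathVisibility_mono h j ω
  local_links j A := by simp only [visibility, pathVisibility_filter]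
  empty j := by simp [visibility, pathVisibility_empty]
  le_bound j A hA := by
    refine (integral_mono (integrable_pathVisibility hM hA j) (integrable_const M.maxVisibility)
      fun ω => (M.pathVisibility_mem_Icc A j ω).2).trans (le_of_eq ?_)
    simp

theorem measure_inaccurate_le (hM : M.IsPostModel P post back) {S : Finset (V × V)}
    (hS : S ⊆ M.links) (j : V) {y : ℝ} (hy : 0 ≤ y) (n : ℕ) :
    (Measure.pi fun _ : Fin n => P).real {x | y * M.maxVisibility <
        |M.empVisibility post back x S j - M.visibility P post back S j|}
      ≤ 2 * Real.exp (-2 * y ^ 2 * n) := by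
  simp only [empVisibility_eq]
  exact hoeffding_mean (measurable_pathVisibility hM hS j) M.maxVisibility_nonneg
    (M.pathVisibility_mem_Icc S j) hy n

/-! ### Simultaneous accuracy for all small sets of links -/

/-- The event that the empirical visibilities of all users are accurate for all sets of at most `L`
links. -/
def accurateEvent (M : Problem V) (P : Measure Ω) (post back : V → Ω → Finset ℝ) (y : ℝ)
    (L n : ℕ) : Set (Fin n → Ω) :=
  {x | ∀ j S, S ⊆ M.links → (S.filter fun e => e.2 = j).card ≤ L →
    |M.empVisibility post back x S j - M.visibility P post back S j| ≤ y * M.maxVisibility}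

theorem measure_compl_accurateEvent_le (hM : M.IsPostModel P post back) {y : ℝ} (hy : 0 ≤ y)
    (L n : ℕ) :
    (Measure.pi fun _ : Fin n => P).real (accurateEvent M P post back y L n)ᶜ
      ≤ (M.links.card : ℝ) ^ L * (2 * Real.exp (-2 * y ^ 2 * n)) := by
  -- A tuple encodes both the set (its range) and the user (the target of entry `0`), so no factor
  -- for the number of users arises. The index `k` with `k.1 = 0` keeps the definition meaningful
  -- for `L = 0`.
  let bad : (Fin L → M.links) → Set (Fin n → Ω) := fun f => {x | ∃ k, y * M.maxVisibility <
    |M.empVisibility post back x (Finset.univ.image fun l => (f l).1) (f k).1.2 -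
      M.visibility P post back (Finset.univ.image fun l => (f l).1) (f k).1.2| ∧ k.1 = 0}
  have hbad : ∀ f, (Measure.pi fun _ : Fin n => P).real (bad f)
      ≤ 2 * Real.exp (-2 * y ^ 2 * n) := fun f => by
    rcases Nat.eq_zero_or_pos L with rfl | hL
    · have : bad f = ∅ := by ext x; simp [bad]
      rw [this, measureReal_empty]
      positivity
    · refine (measureReal_mono (fun x hx => ?_)).trans (measure_inaccurate_le hM
        (S := Finset.univ.image fun l => (f l).1)
        (Finset.image_subset_iff.2 fun l _ => (f l).2) (f ⟨0, hL⟩).1.2 hy n)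
      obtain ⟨k, hk, hk0⟩ := hx
      have : k = ⟨0, hL⟩ := Fin.ext hk0
      rwa [this] at hk
  have hcover : (accurateEvent M P post back y L n)ᶜ ⊆ ⋃ f ∈ (Finset.univ : Finset (Fin L → M.links)),
      bad f := by
    intro x hx
    simp only [accurateEvent, Set.mem_compl_iff, Set.mem_ofPred_eq, not_forall, not_le] at hx
    obtain ⟨j, S, hS, hcard, hlt⟩ := hx
    have hu := isVisibilityFunction_visibility hM
    have huh := M.isVisibilityFunction_empVisibility (post := post) (back := back) x
    rw [← hu.local_links j S, ← huh.local_links j S] at hlt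
    set D := S.filter fun e => e.2 = j with hD
    have hDS : ∀ e ∈ D, e ∈ M.links := fun e he => hS (Finset.mem_filter.1 he).1
    rcases D.eq_empty_or_nonempty with h0 | hne
    · rw [h0, hu.empty, huh.empty, sub_self, abs_zero] at hlt
      exact absurd hlt (not_lt.2 (mul_nonneg hy M.maxVisibility_nonneg))
    · have hpos := hne.card_pos
      -- An enumeration of `D`, padded to length `L` by repeating the last element.
      let g : Fin L → D := fun l => D.equivFin.symm ⟨min l.1 (D.card - 1), by omega⟩
      have himage : (Finset.univ.image fun l => (g l).1) = D := by
        ext e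
        simp only [Finset.mem_image, Finset.mem_univ, true_and]
        refine ⟨?_, fun he => ?_⟩
        · rintro ⟨l, rfl⟩; exact (g l).2
        · refine ⟨⟨(D.equivFin ⟨e, he⟩).1, (D.equivFin ⟨e, he⟩).2.trans_le hcard⟩, ?_⟩
          have : (⟨min (D.equivFin ⟨e, he⟩).1 (D.card - 1), by omega⟩ : Fin D.card) =
              D.equivFin ⟨e, he⟩ := Fin.ext (min_eq_left (by
            have := (D.equivFin ⟨e, he⟩).2
            omega))
          simp only [g, this, Equiv.symm_apply_apply]
      simp only [Finset.mem_univ, Set.iUnion_true, Set.mem_iUnion]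
      refine ⟨fun l => ⟨(g l).1, hDS _ (g l).2⟩, ⟨0, hpos.trans_le hcard⟩, ?_, rfl⟩
      have hj : (g ⟨0, hpos.trans_le hcard⟩).1.2 = j := (Finset.mem_filter.1 (g _).2).2
      simp only [himage, hj]
      exact hlt
  refine (measureReal_mono hcover (measure_ne_top _ _)).trans ((measureReal_biUnion_finset_le _ _).trans
    ((Finset.sum_le_card_nsmul _ _ _ fun f _ => hbad f).trans (le_of_eq ?_)))
  simp

theorem sum_card_walls (M : Problem V) :
    ∑ i ∈ M.broadcasters, ((M.walls i).card : ℝ) = M.links.card := by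
  rw [Finset.card_eq_sum_card_fiberwise (f := Prod.fst) (t := M.broadcasters) M.source_mem]
  push_cast
  refine Finset.sum_congr rfl fun i _ => ?_
  rw [walls, Finset.card_image_of_injOn]
  intro e he e' he' h
  simp only [Finset.coe_filter, Set.mem_ofPred_eq] at he he'
  exact Prod.ext (he.2.trans he'.2.symm) h

theorem greedy_of_accurate [Fintype V] (hM : M.IsPostModel P post back) {y ξ : ℝ} {L n : ℕ}
    (hy : 0 ≤ y) (hL : 1 ≤ y * L)
    (hξ : ξ = 1 - generalizedCurvature M.links (M.avgVisibility P post back)) {x : Fin n → Ω}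
    (hx : x ∈ accurateEvent M P post back y L n) {S : Finset (V × V)}
    (hS : IsGreedyOutput M.links M.Feasible (M.empAvgVisibility post back x) S) :
    ξ / (1 + ξ) * optValue M.links M.Feasible (M.avgVisibility P post back)
        - 4 * y * M.K * (M.tf - M.t₀) * ∑ i ∈ M.broadcasters, (M.budget i : ℝ)
      ≤ M.avgVisibility P post back S := by
  have hu := isVisibilityFunction_visibility hM
  obtain ⟨-, h1, hsub⟩ := generalizedCurvature_mem (f := M.avgVisibility P post back) hu.sum_mono
  have hξ0 : 0 ≤ ξ := by linarith
  rw [show generalizedCurvature M.links (M.avgVisibility P post back) = 1 - ξ by linarith] at hsub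
  have hA : ∀ A, M.Feasible A → ξ * M.avgVisibility P post back A ≤ (1 + ξ) *
      (M.avgVisibility P post back S +
        4 * (y * M.maxVisibility) * ∑ i ∈ M.broadcasters, (M.budget i : ℝ)) := fun A hA =>
    greedy_approx M.maxVisibility_nonneg hy hL hu (M.isVisibilityFunction_empVisibility x) hξ0 hsub
      hx hS hA
  set W := M.avgVisibility P post back S +
        4 * (y * M.maxVisibility) * ∑ i ∈ M.broadcasters, (M.budget i : ℝ) with hW
  have hmain : ξ * optValue M.links M.Feasible (M.avgVisibility P post back) ≤ (1 + ξ) * W := by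
    -- For `ξ = 0` the claim is only that the right side is nonnegative, obtained from `A = ∅`;
    -- otherwise dividing by `ξ` allows the supremum to be taken.
    rcases hξ0.eq_or_lt with h0 | hpos
    · have h := hA ∅ ⟨Finset.empty_subset _, by simp⟩
      rw [← h0] at h ⊢
      linarith
    · rw [← le_div_iff₀' hpos]
      refine csSup_le ⟨_, ∅, Finset.empty_subset _, ⟨Finset.empty_subset _, by simp⟩, rfl⟩ ?_
      rintro _ ⟨A, -, hAf, rfl⟩
      rw [le_div_iff₀' hpos]
      exact hA A hAf
  have hdiv : ξ / (1 + ξ) * optValue M.links M.Feasible (M.avgVisibility P post back) ≤ W := by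
    rw [div_mul_eq_mul_div, div_le_iff₀' (by linarith)]
    exact hmain
  rw [hW, maxVisibility] at hdiv
  linarith

end Problem

end Visibility

/-! ### Sample size and conclusion -/

/-- The number of realizations suffices for the union bound. -/
theorem union_bound_le {N δ r m : ℝ} {L : ℕ} (hL : L ≠ 0) (hN : 0 ≤ N) (hδ : 0 < δ) (hδ1 : δ ≤ 1)
    (hr : 0 < r) (hm : (Real.log 2 + Real.log (N / δ)) / (r / L) ≤ m) :
    N ^ L * (2 * Real.exp (-r * m)) ≤ δ := by
  rcases hN.eq_or_lt with rfl | hN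
  · rw [zero_pow hL, zero_mul]
    exact hδ.le
  have hL0 : (0 : ℝ) < L := by exact_mod_cast Nat.pos_of_ne_zero hL
  rw [div_le_iff₀ (by positivity), ← Real.log_mul (by norm_num) (by positivity)] at hm
  have h1 : Real.exp (-(m * (r / L))) ≤ δ / (2 * N) := by
    refine (Real.exp_le_exp.2 (neg_le_neg hm)).trans (le_of_eq ?_)
    rw [Real.exp_neg, Real.exp_log (by positivity)]
    field_simp
  have h2 : Real.exp (-r * m) = Real.exp (-(m * (r / L))) ^ L := by
    rw [← Real.exp_nat_mul]
    congr 1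
    field_simp
  have h3 : N * (δ / (2 * N)) = δ / 2 := by field_simp
  -- The sample size is chosen so that the `L`-th root of the exponential is at most `δ / (2 * N)`;
  -- the powers of `N` then cancel.
  calc N ^ L * (2 * Real.exp (-r * m)) ≤ N ^ L * (2 * (δ / (2 * N)) ^ L) := by
        rw [h2]; gcongr
    _ = 2 * (δ / 2) ^ L := by rw [← h3, mul_pow]; ring
    _ ≤ 2 * (δ / 2) := by
        gcongr
        exact pow_le_of_le_one (by positivity) (by linarith) hL
    _ = δ := by ring

/-- Subadditivity alone suffices, so the event about all greedy outputs need not be shown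
measurable. -/
theorem one_sub_le_measureReal {α : Type*} [MeasurableSpace α] {μ : Measure α}
    [IsProbabilityMeasure μ] {s t : Set α} {ε : ℝ} (hst : tᶜ ⊆ s) (ht : μ.real t ≤ ε) :
    1 - ε ≤ μ.real s := by
  have h1 : μ.real (s ∪ t) = 1 := by
    rw [Set.eq_univ_of_forall (s := s ∪ t) fun a => (em (a ∈ t)).elim Or.inr fun h => Or.inl (hst h), probReal_univ]
  have h2 := measureReal_union_le (μ := μ) s t
  linarith

end LinkRec

theorem mainTheorem8 :
    ∃ Z Q : ℝ → ℝ, (∀ y : ℝ, 0 < y → y ≤ 1 → 0 < Q y) ∧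
      ∀ (V : Type*) [Fintype V] [DecidableEq V] (M : LinkRec.Problem V)
        (Ω : Type*) [MeasurableSpace Ω] (P : Measure Ω) [IsProbabilityMeasure P]
        (post back : V → Ω → Finset ℝ), M.IsPostModel P post back →
      ∀ y : ℝ, 0 < y → y ≤ 1 →
        -- `Z y` and `Q y` are constants in the error bound of the empirical visibilities
        (∀ (n : ℕ) (S : Finset (V × V)) (j : V), S ⊆ M.links →
          1 - Real.exp (Z y - Q y * n) ≤
            (Measure.pi fun _ : Fin n => P).real
              {x | M.visibility P post back S j - y * M.K * (M.tf - M.t₀)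
                    ≤ M.empVisibility post back x S j ∧
                  M.empVisibility post back x S j
                    ≤ M.visibility P post back S j + y * M.K * (M.tf - M.t₀)}) ∧
        -- the guarantee for the greedy algorithm that uses the empirical visibilities;
        -- `ξ / (1 + ξ)` is `1 / (1 / ξ + 1)`, read as `0` for `ξ = 0`
        (∀ (n : ℕ) (δ ξ : ℝ), 0 < δ →
          ξ = 1 - LinkRec.generalizedCurvature M.links (M.avgVisibility P post back) →
          (Z y + Real.log ((∑ i ∈ M.broadcasters, ((M.walls i).card : ℝ)) / δ)) / Q y ≤ n →
          1 - δ ≤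
            (Measure.pi fun _ : Fin n => P).real
              {x | ∀ S : Finset (V × V),
                LinkRec.IsGreedyOutput M.links M.Feasible (M.empAvgVisibility post back x) S →
                ξ / (1 + ξ) *
                      LinkRec.optValue M.links M.Feasible (M.avgVisibility P post back)
                    - 4 * y * M.K * (M.tf - M.t₀) * ∑ i ∈ M.broadcasters, (M.budget i : ℝ)
                  ≤ M.avgVisibility P post back S}) := by
  have hceil : ∀ y : ℝ, 0 < y → 1 ≤ y * (⌈1 / y⌉₊ : ℝ) := fun y hy => by
    have := mul_le_mul_of_nonneg_left (Nat.le_ceil (1 / y)) hy.le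
    rwa [mul_one_div_cancel hy.ne'] at this
  have hL0 : ∀ y : ℝ, 0 < y → ⌈1 / y⌉₊ ≠ 0 := fun y hy =>
    (Nat.ceil_pos.2 (by positivity)).ne'
  have hL1 : ∀ y : ℝ, 0 < y → (1 : ℝ) ≤ ⌈1 / y⌉₊ := fun y hy => by
    exact_mod_cast Nat.one_le_iff_ne_zero.2 (hL0 y hy)
  -- The `log 2` is Hoeffding's two-sided factor, `2 * y ^ 2` its rate, and the divisor absorbs the
  -- `L`-th power of the number of links in the union bound.
  refine ⟨fun _ => Real.log 2, fun y => 2 * y ^ 2 / ⌈1 / y⌉₊, fun y hy _ => ?_, ?_⟩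
  · have := hL1 y hy
    positivity
  intro V _ _ M Ω _ P _ post back hM y hy _
  refine ⟨fun n S j hS => ?_, fun n δ ξ hδ hξ hn => ?_⟩
  · refine LinkRec.one_sub_le_measureReal (fun x hx => ?_)
      ((LinkRec.Problem.measure_inaccurate_le hM hS j hy.le n).trans ?_)
    · rw [Set.mem_compl_iff, Set.mem_ofPred_eq, not_lt, abs_le, LinkRec.Problem.maxVisibility] at hx
      constructor <;> linarith [hx.1, hx.2]
    · rw [sub_eq_add_neg, Real.exp_add, Real.exp_log two_pos]
      have h1 : 2 * y ^ 2 / (⌈1 / y⌉₊ : ℝ) ≤ 2 * y ^ 2 := div_le_self (by positivity) (hL1 y hy)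
      have h2 := mul_le_mul_of_nonneg_right h1 (Nat.cast_nonneg (α := ℝ) n)
      gcongr
      linarith
  · rcases le_or_gt δ 1 with hδ1 | hδ1
    · rw [LinkRec.Problem.sum_card_walls] at hn
      refine LinkRec.one_sub_le_measureReal (fun x hx S hS => ?_)
        ((LinkRec.Problem.measure_compl_accurateEvent_le hM hy.le ⌈1 / y⌉₊ n).trans ?_)
      · exact LinkRec.Problem.greedy_of_accurate hM hy.le (hceil y hy) hξ
          (Set.notMem_compl_iff.1 hx) hS
      · have := LinkRec.union_bound_le (hL0 y hy) (Nat.cast_nonneg _) hδ hδ1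
          (by positivity : 0 < 2 * y ^ 2) hn
        rwa [neg_mul]
    -- For `δ > 1` the claimed lower bound on the probability is negative.
    · exact (by linarith : 1 - δ ≤ 0).trans measureReal_nonneg
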